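/- There is an absolute constant $c$ with the following property. Let $\mathfrak{L}$ be a finite set of $L$ lines in $\mathbb{R}^3$, and let $J$ be its set of joints, that is, the set of points $x\in\mathbb{R}^3$ through which there pass at least three lines of $\mathfrak{L}$ whose directions span $\mathbb{R}^3$. For each $x\in J$ let $N(x)$ be the number of unordered triples of distinct lines of $\mathfrak{L}$ passing through $x$ whose directions span $\mathbb{R}^3$ (that is, triples of non-coplanar lines through $x$). Then $J$ is finite and $$\sum_{x\in J} N(x)^{1/2}\le c\, L^{3/2}.$$ -/

import Mathlib

/-- Three-dimensional real Euclidean space. -/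
abbrev R3 : Type := EuclideanSpace ℝ (Fin 3)

/-- A line in `ℝ³`: an affine subspace whose direction is one-dimensional. Such a subspace is
automatically nonempty, since the empty affine subspace has direction `0`. -/
def IsLine (l : AffineSubspace ℝ R3) : Prop :=
  Module.finrank ℝ l.direction = 1

/-- All members of `S` pass through `x`, and their directions together span `ℝ³`. -/
def SpanAt (S : Finset (AffineSubspace ℝ R3)) (x : R3) : Prop :=
  (∀ l ∈ S, x ∈ l) ∧ (⨆ l ∈ S, l.direction) = ⊤

/-- The set of joints of `𝔏`: the points through which there pass at least three lines of `𝔏`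
whose directions span `ℝ³`. -/
def joints (𝔏 : Finset (AffineSubspace ℝ R3)) : Set R3 :=
  {x | ∃ S ⊆ 𝔏, 3 ≤ S.card ∧ SpanAt S x}

/-- The multiplicity of `x`: the number of unordered triples of (distinct) lines of `𝔏` through
`x` whose directions span `ℝ³`. This is the cardinality of a finite set, because all these
triples are subsets of the finite set `𝔏`. -/
noncomputable def jointMultiplicity (𝔏 : Finset (AffineSubspace ℝ R3)) (x : R3) : ℕ :=
  {T : Finset (AffineSubspace ℝ R3) | T ⊆ 𝔏 ∧ T.card = 3 ∧ SpanAt T x}.ncard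

/-! Polynomial method with multiplicities and handicaps. Give each point `p` a handicap `h p`, and
let conditions of order `r` at `p` precede those with larger `r - h p`. On a line, a polynomial of
degree at most `D` has at most `D` zeros, so once more than `D` vanishing conditions precede an
order at `p`, that derivative along the line vanishes automatically. Hence at `p`, with a spanning
triple of lines chosen, only exponents below the three free orders need to be imposed
(`eq_zero_of_freeOrder`). Comparing with the polynomials of degree at most `K` in each variable, `D
= 3 * K`, bounds the sum of products of free orders below by `(K + 1) ^ 3`.

Raising a handicap raises the free orders there by at most one and those elsewhere not at all. A
maximal admissible `h` therefore makes every triple at every `p` carry at least about the share `w p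
/ S` of `K ^ 3` conditions, where `S = ∑ w` (`exists_handicap`).

Take `w = N ^ (1/2)`. Summing over the `w p ^ 2` triples at `p` bounds `(K * w p) ^ 3` by `S` times
the cube of the sum of (free order + 1) over the lines through `p`. The free orders along one line
sum to at most `D + |P|` (`sum_freeOrder_le`), so with `K = |P|` summation over `p` gives `S ≤ S ^
(1/3) * 5L`. -/

/-! ### Directional derivatives and vanishing at a point -/

open MvPolynomial in
/-- The derivative of a polynomial in the direction of a constant vector. -/
noncomputable def dirDeriv {σ : Type*} (v : σ → ℝ) :
    Derivation ℝ (MvPolynomial σ ℝ) (MvPolynomial σ ℝ) :=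
  MvPolynomial.mkDerivation ℝ fun i => C (v i)

namespace dirDeriv

open MvPolynomial

variable {σ : Type*}

theorem _root_.Derivation.finset_sum_apply {ι R A M : Type*} [CommSemiring R] [CommSemiring A]
    [AddCommMonoid M] [Algebra R A] [Module A M] [Module R M] (s : Finset ι)
    (D : ι → Derivation R A M) (a : A) : (∑ j ∈ s, D j) a = ∑ j ∈ s, D j a := by
  classical
  induction s using Finset.induction_on with
  | empty => simp
  | insert j s hj ih => rw [Finset.sum_insert hj, Finset.sum_insert hj, Derivation.add_apply, ih]

theorem apply_X (v : σ → ℝ) (i : σ) : dirDeriv v (X i) = C (v i) :=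
  mkDerivation_X _ _ _

/-- The commutator of two derivations is a derivation, and here it kills every variable. -/
theorem comm (v w : σ → ℝ) (f : MvPolynomial σ ℝ) :
    dirDeriv v (dirDeriv w f) = dirDeriv w (dirDeriv v f) := by
  have h : ⁅dirDeriv v, dirDeriv w⁆ = 0 := by
    apply derivation_ext
    intro i
    simp [Derivation.commutator_apply, apply_X]
  have := congrArg (fun D => D f) h
  simpa [Derivation.commutator_apply, sub_eq_zero] using this

theorem sum_smul {ι : Type*} (s : Finset ι) (c : ι → ℝ) (v : ι → σ → ℝ) (f : MvPolynomial σ ℝ) :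
    dirDeriv (∑ j ∈ s, c j • v j) f = ∑ j ∈ s, c j • dirDeriv (v j) f := by
  have h : dirDeriv (∑ j ∈ s, c j • v j) = ∑ j ∈ s, c j • dirDeriv (v j) := by
    apply derivation_ext
    intro i
    simp [apply_X, Derivation.finset_sum_apply, smul_eq_C_mul, Finset.sum_apply]
  rw [h]
  simp [Derivation.finset_sum_apply]

theorem eq_sum_pderiv [Fintype σ] (v : σ → ℝ) (f : MvPolynomial σ ℝ) :
    dirDeriv v f = ∑ i, v i • pderiv i f := by
  classical
  have h : dirDeriv v = ∑ i, v i • pderiv i := by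
    apply derivation_ext
    intro i
    simp [apply_X, Derivation.finset_sum_apply, pderiv_X, Pi.single_apply, smul_eq_C_mul]
  rw [h]
  simp [Derivation.finset_sum_apply]

theorem totalDegree_le [Fintype σ] (v : σ → ℝ) {f : MvPolynomial σ ℝ} {d : ℕ}
    (hf : f.totalDegree ≤ d) : (dirDeriv v f).totalDegree ≤ d := by
  rw [eq_sum_pderiv]
  refine totalDegree_finsetSum_le fun i _ => (totalDegree_smul_le _ _).trans ?_
  refine Finset.sup_le fun m hm => ?_
  rw [mem_support_iff, coeff_pderiv] at hm
  have h := (le_totalDegree (mem_support_iff.2 (left_ne_zero_of_mul hm))).trans hf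
  rw [Finsupp.sum_add_index' (fun _ => rfl) (fun _ _ _ => rfl)] at h
  omega

theorem totalDegree_iterate_le [Fintype σ] (v : σ → ℝ) {f : MvPolynomial σ ℝ} {d : ℕ}
    (hf : f.totalDegree ≤ d) (n : ℕ) : ((dirDeriv v)^[n] f).totalDegree ≤ d := by
  induction n with
  | zero => exact hf
  | succ n ih => rw [Function.iterate_succ_apply']; exact totalDegree_le v ih

theorem iterate_comm (v w : σ → ℝ) (m n : ℕ) (f : MvPolynomial σ ℝ) :
    (dirDeriv v)^[m] ((dirDeriv w)^[n] f) = (dirDeriv w)^[n] ((dirDeriv v)^[m] f) :=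
  (Function.Commute.iterate_iterate (f := dirDeriv v) (g := dirDeriv w) (comm v w) m n) f

theorem iterate_comm_apply (v w : σ → ℝ) (m : ℕ) (f : MvPolynomial σ ℝ) :
    (dirDeriv v)^[m] (dirDeriv w f) = dirDeriv w ((dirDeriv v)^[m] f) :=
  (Function.Commute.iterate_left (f := dirDeriv v) (g := dirDeriv w) (comm v w) m) f

end dirDeriv

/-- All derivatives of order exactly `r` of the polynomial `f` vanish at the point `p`. -/
def DerivsVanishAt {σ : Type*} (p : σ → ℝ) : ℕ → MvPolynomial σ ℝ → Prop
  | 0, f => MvPolynomial.eval p f = 0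
  | r + 1, f => ∀ v, DerivsVanishAt p r (dirDeriv v f)

namespace DerivsVanishAt

open MvPolynomial

variable {σ : Type*} {p : σ → ℝ}

theorem smul_sum {ι : Type*} (s : Finset ι) (c : ι → ℝ) (r : ℕ) (f : ι → MvPolynomial σ ℝ)
    (h : ∀ j ∈ s, DerivsVanishAt p r (f j)) : DerivsVanishAt p r (∑ j ∈ s, c j • f j) := by
  induction r generalizing f with
  | zero =>
    simp only [DerivsVanishAt] at *
    rw [map_sum]
    exact Finset.sum_eq_zero fun j hj => by rw [smul_eval, h j hj, mul_zero]
  | succ r ih =>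
    intro v
    rw [map_sum]
    simp only [Derivation.map_smul]
    exact ih _ fun j hj => h j hj v

theorem iterate {r s : ℕ} {f : MvPolynomial σ ℝ} (h : DerivsVanishAt p (r + s) f) (v : σ → ℝ) :
    DerivsVanishAt p r ((dirDeriv v)^[s] f) := by
  induction s generalizing f with
  | zero => exact h
  | succ s ih => exact ih (h v)

/-- Derivatives of order `r` vanish as soon as those along the vectors of a spanning triple do. -/
theorem of_span (v : Fin 3 → σ → ℝ) (hv : Submodule.span ℝ (Set.range v) = ⊤) (r : ℕ)
    (f : MvPolynomial σ ℝ)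
    (h : ∀ α : Fin 3 → ℕ, α 0 + α 1 + α 2 = r → eval p ((dirDeriv (v 0))^[α 0]
      ((dirDeriv (v 1))^[α 1] ((dirDeriv (v 2))^[α 2] f))) = 0) :
    DerivsVanishAt p r f := by
  induction r generalizing f with
  | zero => exact h 0 rfl
  | succ r ih =>
    intro w
    obtain ⟨c, rfl⟩ := (Submodule.mem_span_range_iff_exists_fun ℝ).1
      (hv ▸ Submodule.mem_top : w ∈ Submodule.span ℝ (Set.range v))
    rw [dirDeriv.sum_smul]
    refine smul_sum _ _ _ _ fun j _ => ih _ fun α hα => ?_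
    have key := h (α + Pi.single j 1)
    fin_cases j
    · simp only [Pi.add_apply] at key
      simp at key
      change eval p (_^[_] (_^[_] (_^[_] (dirDeriv (v 0) f)))) = 0
      rw [dirDeriv.iterate_comm_apply, dirDeriv.iterate_comm_apply]
      exact key (by omega)
    · simp only [Pi.add_apply] at key
      simp at key
      change eval p (_^[_] (_^[_] (_^[_] (dirDeriv (v 1) f)))) = 0
      rw [dirDeriv.iterate_comm_apply]
      exact key (by omega)
    · simp only [Pi.add_apply] at key
      simp at key
      exact key (by omega)

end DerivsVanishAt

/-! ### Restriction to lines and zeros with multiplicity -/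

/-- The restriction of a polynomial to the line `t ↦ p + t v`. -/
noncomputable def restrictLine {σ : Type*} (p v : σ → ℝ) :
    MvPolynomial σ ℝ →ₐ[ℝ] Polynomial ℝ :=
  MvPolynomial.aeval fun i => Polynomial.C (p i) + Polynomial.C (v i) * Polynomial.X

namespace restrictLine

variable {σ : Type*} (p v : σ → ℝ)

theorem eval_eq (f : MvPolynomial σ ℝ) (t : ℝ) :
    (restrictLine p v f).eval t = MvPolynomial.eval (p + t • v) f := by
  induction f using MvPolynomial.induction_on with
  | C a => simp [restrictLine]
  | add f g hf hg => simp [hf, hg]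
  | mul_X f i hf => rw [map_mul, Polynomial.eval_mul, hf]; simp [restrictLine, mul_comm t]

theorem derivative_eq (f : MvPolynomial σ ℝ) :
    Polynomial.derivative (restrictLine p v f) = restrictLine p v (dirDeriv v f) := by
  induction f using MvPolynomial.induction_on with
  | C a => simp [restrictLine]
  | add f g hf hg => simp [hf, hg]
  | mul_X f i hf =>
    rw [map_mul, Polynomial.derivative_mul, hf, Derivation.leibniz, dirDeriv.apply_X]
    simp only [restrictLine, smul_eq_mul, map_add, map_mul, MvPolynomial.aeval_X,
      MvPolynomial.algHom_C, Polynomial.derivative_C, Polynomial.derivative_X,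
      Polynomial.derivative_mul, Polynomial.algebraMap_eq]
    ring

theorem iterate_derivative_eq (f : MvPolynomial σ ℝ) (n : ℕ) :
    Polynomial.derivative^[n] (restrictLine p v f) = restrictLine p v ((dirDeriv v)^[n] f) := by
  induction n generalizing f with
  | zero => rfl
  | succ n ih => rw [Function.iterate_succ_apply, derivative_eq, ih]; rfl

theorem natDegree_le {f : MvPolynomial σ ℝ} {d : ℕ} (hf : f.totalDegree ≤ d) :
    (restrictLine p v f).natDegree ≤ d := by
  have := MvPolynomial.aeval_natDegree_le f hf
    (fun i => Polynomial.C (p i) + Polynomial.C (v i) * Polynomial.X) (n := 1)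
    (fun i => by compute_degree)
  simpa [restrictLine] using this

end restrictLine

/-- A polynomial of degree at most `d` that has more than `d` zeros, counted with
multiplicity, is zero. -/
theorem Polynomial.eq_zero_of_iterate_derivative_eval {g : Polynomial ℝ} {d : ℕ}
    (hg : g.natDegree ≤ d) (s : Finset ℝ) (m : ℝ → ℕ) (hm : d < ∑ t ∈ s, m t)
    (h : ∀ t ∈ s, ∀ r < m t, (derivative^[r] g).eval t = 0) : g = 0 := by
  by_contra hne
  have h1 : ∀ t ∈ s, m t ≤ g.rootMultiplicity t := by
    intro t ht
    rcases Nat.eq_zero_or_pos (m t) with h0 | h0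
    · omega
    · have := (Polynomial.lt_rootMultiplicity_iff_isRoot_iterate_derivative (n := m t - 1)
        hne (t := t)).2 fun r hr => h t ht r (by omega)
      omega
  have h2 : ∑ t ∈ s, m t ≤ g.roots.card := by
    calc ∑ t ∈ s, m t ≤ ∑ t ∈ s, g.roots.count t :=
          Finset.sum_le_sum fun t ht => (count_roots g (a := t)) ▸ h1 t ht
      _ ≤ ∑ t ∈ s ∪ g.roots.toFinset, g.roots.count t :=
          Finset.sum_le_sum_of_subset Finset.subset_union_left
      _ = g.roots.card := Multiset.sum_count_eq_card fun a ha =>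
          Finset.mem_union_right _ (Multiset.mem_toFinset.2 ha)
  have := g.card_roots'
  omega

/-- A polynomial all of whose derivatives vanish at one point is zero. -/
theorem DerivsVanishAt.eq_zero {σ : Type*} {p : σ → ℝ} {f : MvPolynomial σ ℝ}
    (h : ∀ r, DerivsVanishAt p r f) : f = 0 := by
  apply MvPolynomial.funext
  intro x
  have hz : restrictLine p (x - p) f = 0 := by
    refine Polynomial.eq_zero_of_iterate_derivative_eval le_rfl {0}
      (fun _ => (restrictLine p (x - p) f).natDegree + 1) (by simp) ?_
    intro t ht r _
    rw [Finset.mem_singleton] at ht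
    rw [restrictLine.iterate_derivative_eq, restrictLine.eval_eq, ht, zero_smul, add_zero]
    exact DerivsVanishAt.iterate (r := 0) (by simpa using h r) _
  have := restrictLine.eval_eq p (x - p) f 1
  rw [hz] at this
  simpa using this.symm

/-! ### Handicaps and free orders -/

/-- The number of pairs `(q, s)`, with `q` a point of `P` on `l` and `s : ℕ`, for which
`s - h q < r - h p`. -/
noncomputable def precedingCount (P : Finset R3) (h : R3 → ℕ) (l : AffineSubspace ℝ R3) (p : R3)
    (r : ℕ) : ℕ :=
  open Classical in ∑ q ∈ P with q ∈ l, (h q + r - h p)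

/-- With the pairs `(q, s)` ordered by the handicapped order `s - h q`, this is the number of
orders of derivative at `p` along `l` that are preceded by at most `D` pairs. -/
noncomputable def freeOrder (P : Finset R3) (h : R3 → ℕ) (D : ℕ) (l : AffineSubspace ℝ R3)
    (p : R3) : ℕ :=
  sInf {r | D < precedingCount P h l p r}

section freeOrder

variable {P : Finset R3} {h : R3 → ℕ} {D : ℕ} {l : AffineSubspace ℝ R3} {p q : R3}

theorem precedingCount_mono {r s : ℕ} (hrs : r ≤ s) :
    precedingCount P h l p r ≤ precedingCount P h l p s :=
  Finset.sum_le_sum fun _ _ => by omega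

theorem le_precedingCount (hp : p ∈ P) (hl : p ∈ l) (r : ℕ) : r ≤ precedingCount P h l p r := by
  classical
  calc r = h p + r - h p := by omega
    _ ≤ _ := Finset.single_le_sum (f := fun q => h q + r - h p) (fun _ _ => Nat.zero_le _)
      (Finset.mem_filter.2 ⟨hp, hl⟩)

theorem freeOrder_le {r : ℕ} (hr : D < precedingCount P h l p r) : freeOrder P h D l p ≤ r :=
  Nat.sInf_le hr

theorem precedingCount_le_of_lt_freeOrder {r : ℕ} (hr : r < freeOrder P h D l p) :
    precedingCount P h l p r ≤ D :=
  not_lt.1 fun hD => (freeOrder_le hD).not_gt hr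

theorem lt_precedingCount_of_freeOrder_le (hp : p ∈ P) (hl : p ∈ l) {r : ℕ}
    (hr : freeOrder P h D l p ≤ r) : D < precedingCount P h l p r :=
  (Nat.sInf_mem (s := {r | D < precedingCount P h l p r})
    ⟨D + 1, le_precedingCount hp hl (D + 1)⟩).trans_le (precedingCount_mono hr)

/-- With the handicap of `p` raised by one, order `r + 1` at `p` has the handicapped position that
`r` had before, so at least as many pairs precede it. -/
theorem freeOrder_update_self_le (hp : p ∈ P) (hl : p ∈ l) :
    freeOrder P (Function.update h p (h p + 1)) D l p ≤ freeOrder P h D l p + 1 := by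
  refine freeOrder_le ((lt_precedingCount_of_freeOrder_le (h := h) hp hl le_rfl).trans_le ?_)
  refine Finset.sum_le_sum fun q _ => ?_
  rw [Function.update_self, Function.update_apply]
  split_ifs with hq
  · subst hq; omega
  · omega

/-- A larger handicap at `p` can only put more pairs ahead of a given order at `q`. -/
theorem freeOrder_update_of_ne_le (hq : q ∈ P) (hl : q ∈ l) (hqp : q ≠ p) :
    freeOrder P (Function.update h p (h p + 1)) D l q ≤ freeOrder P h D l q := by
  refine freeOrder_le ((lt_precedingCount_of_freeOrder_le (h := h) hq hl le_rfl).trans_le ?_)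
  refine Finset.sum_le_sum fun a _ => ?_
  rw [Function.update_of_ne hqp, Function.update_apply]
  split_ifs with ha
  · subst ha; omega
  · omega

/-- Among points with positive free order, let `m` maximize free order minus handicap. At most `D`
pairs precede the last free order at `m`, and they account for all free orders on the line except at
most one per point, owing to ties. -/
theorem sum_freeOrder_le (P : Finset R3) (h : R3 → ℕ) (D : ℕ) (l : AffineSubspace ℝ R3)
    [DecidablePred (· ∈ l)] :
    ∑ p ∈ P with p ∈ l, freeOrder P h D l p ≤ D + P.card := by
  classical
  set s := P.filter (· ∈ l) with hs
  set s' := s.filter fun p => 0 < freeOrder P h D l p with hs'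
  rcases s'.eq_empty_or_nonempty with he | hne
  · have : ∑ p ∈ s, freeOrder P h D l p = 0 := Finset.sum_eq_zero fun p hp => by
      by_contra h0
      exact Finset.notMem_empty p (he ▸ Finset.mem_filter.2 ⟨hp, Nat.pos_of_ne_zero h0⟩)
    omega
  · obtain ⟨m, hm, hmax⟩ :=
      Finset.exists_max_image s' (fun p => (freeOrder P h D l p : ℤ) - h p) hne
    have hm' := Finset.mem_filter.1 hm
    have hcount := precedingCount_le_of_lt_freeOrder (r := freeOrder P h D l m - 1)
      (by omega : _ < freeOrder P h D l m)
    calc ∑ p ∈ s, freeOrder P h D l p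
        ≤ ∑ p ∈ s, ((h p + (freeOrder P h D l m - 1) - h m) + 1) := by
          refine Finset.sum_le_sum fun p hp => ?_
          rcases Nat.eq_zero_or_pos (freeOrder P h D l p) with h0 | h0
          · omega
          · have := hmax p (Finset.mem_filter.2 ⟨hp, h0⟩)
            omega
      _ = precedingCount P h l m (freeOrder P h D l m - 1) + s.card := by
          rw [Finset.sum_add_distrib, Finset.sum_const, smul_eq_mul, mul_one, precedingCount, hs]
          congr!
      _ ≤ D + P.card := add_le_add hcount (Finset.card_filter_le _ _)

/-- Points whose handicap lies far below that of `p` do not affect the free order at `p`. -/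
theorem freeOrder_eq_of_gap {A : Finset R3} (hAP : A ⊆ P) (hp : p ∈ A) (hl : p ∈ l)
    (hgap : ∀ q ∈ P, q ∉ A → h q + D < h p) :
    freeOrder A h D l p = freeOrder P h D l p := by
  classical
  unfold freeOrder
  congr 1
  ext r
  rw [Set.mem_ofPred_eq, Set.mem_ofPred_eq]
  -- For `r ≤ D` the points outside `A` contribute `0` by truncated subtraction; for `r > D` the
  -- point `p` alone pushes both counts above `D`.
  rcases le_or_gt r D with hr | hr
  · have : precedingCount A h l p r = precedingCount P h l p r := by
      refine Finset.sum_subset (Finset.filter_subset_filter _ hAP) fun q hq hqA => ?_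
      rw [Finset.mem_filter] at hq hqA
      have := hgap q hq.1 fun h => hqA ⟨h, hq.2⟩
      omega
    rw [this]
  · exact ⟨fun _ => hr.trans_le (le_precedingCount (hAP hp) hl r),
      fun _ => hr.trans_le (le_precedingCount hp hl r)⟩

end freeOrder

/-! ### Vanishing lemma and parameter counting -/

open MvPolynomial

/-- The prescribed zeros of `g` on `l`, counted with multiplicity, number `precedingCount P h l p a
> D`, so `g` vanishes identically on `l`, and so do its derivatives along `l`. -/
theorem iterate_dirDeriv_eval_eq_zero {P : Finset R3} {h : R3 → ℕ} {D : ℕ}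
    {l : AffineSubspace ℝ R3} {p v : R3} (hpar : ∀ q ∈ l, ∃ t : ℝ, q = p + t • v)
    {g : MvPolynomial (Fin 3) ℝ} (hg : g.totalDegree ≤ D) {a : ℕ}
    (ha : D < precedingCount P h l p a)
    (hv : ∀ q ∈ P, q ∈ l → ∀ r < h q + a - h p, DerivsVanishAt q.ofLp r g) :
    eval p.ofLp ((dirDeriv v.ofLp)^[a] g) = 0 := by
  classical
  choose! τ hτ using hpar
  have hinj : Set.InjOn τ (P.filter (· ∈ l) : Finset R3) := by
    intro x hx y hy hxy
    rw [Finset.mem_coe, Finset.mem_filter] at hx hy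
    rw [hτ x hx.2, hτ y hy.2, hxy]
  have hz : restrictLine p.ofLp v.ofLp g = 0 := by
    refine Polynomial.eq_zero_of_iterate_derivative_eval (restrictLine.natDegree_le _ _ hg)
      ((P.filter (· ∈ l)).image τ) (fun t => h (p + t • v) + a - h p) ?_ ?_
    · rw [Finset.sum_image hinj]
      refine ha.trans_le (Finset.sum_le_sum fun q hq => ?_)
      rw [← hτ q (Finset.mem_filter.1 hq).2]
    · intro t ht r hr
      obtain ⟨q, hq, rfl⟩ := Finset.mem_image.1 ht
      rw [Finset.mem_filter] at hq
      rw [← hτ q hq.2] at hr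
      rw [restrictLine.iterate_derivative_eq, restrictLine.eval_eq]
      have := (hv q hq.1 hq.2 r hr)
      rw [hτ q hq.2] at this
      exact DerivsVanishAt.iterate (r := 0) (by simpa using this) _
  have := restrictLine.eval_eq p.ofLp v.ofLp ((dirDeriv v.ofLp)^[a] g) 0
  rw [← restrictLine.iterate_derivative_eq, hz, zero_smul, add_zero] at this
  rw [← this]
  simp

/-- A polynomial of degree at most `D` vanishes if, at each point of `P`, its derivatives along
a triple of lines vanish for all exponents below the free orders. -/
theorem eq_zero_of_freeOrder {P : Finset R3} (hP : P.Nonempty) (h : R3 → ℕ) (D : ℕ)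
    (l : R3 → Fin 3 → AffineSubspace ℝ R3) (v : R3 → Fin 3 → R3)
    (hl : ∀ p ∈ P, ∀ i, p ∈ l p i)
    (hpar : ∀ p ∈ P, ∀ i, ∀ q ∈ l p i, ∃ t : ℝ, q = p + t • v p i)
    (hspan : ∀ p ∈ P, Submodule.span ℝ (Set.range fun i => (v p i).ofLp) = ⊤)
    {f : MvPolynomial (Fin 3) ℝ} (hf : f.totalDegree ≤ D)
    (hvan : ∀ p ∈ P, ∀ α : Fin 3 → ℕ, (∀ i, α i < freeOrder P h D (l p i) p) →
      eval p.ofLp ((dirDeriv (v p 0).ofLp)^[α 0] ((dirDeriv (v p 1).ofLp)^[α 1]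
        ((dirDeriv (v p 2).ofLp)^[α 2] f))) = 0) : f = 0 := by
  obtain ⟨M, hM⟩ : ∃ M, ∀ p ∈ P, h p ≤ M := ⟨P.sup h, fun p hp => Finset.le_sup hp⟩
  -- Induction along the handicapped order `r - h p`, shifted by `M` to stay in `ℕ`.
  have key : ∀ n, ∀ p ∈ P, ∀ r, r + (M - h p) = n → DerivsVanishAt p.ofLp r f := by
    intro n
    induction n using Nat.strong_induction_on with
    | _ n ih =>
    intro p hp r hr
    refine DerivsVanishAt.of_span _ (hspan p hp) r f fun α hα => ?_
    by_cases hlt : ∀ i, α i < freeOrder P h D (l p i) p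
    · exact hvan p hp α hlt
    · push Not at hlt
      obtain ⟨i, hi⟩ := hlt
      -- With `s` the order of differentiation in the other two directions, `r' - h q < α i - h p`
      -- gives `r' + s - h q < r - h p`, so the induction hypothesis applies.
      have hprev : ∀ s, α i + s = r → ∀ q ∈ P, ∀ r' < h q + α i - h p,
          DerivsVanishAt q.ofLp (r' + s) f := by
        intro s hs q hq r' hr'
        refine ih _ ?_ q hq (r' + s) rfl
        have := hM p hp
        have := hM q hq
        omega
      have hD := lt_precedingCount_of_freeOrder_le hp (hl p hp i) hi
      fin_cases i
      · refine iterate_dirDeriv_eval_eq_zero (hpar p hp 0) (D := D) ?_ hD ?_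
        · exact dirDeriv.totalDegree_iterate_le _ (dirDeriv.totalDegree_iterate_le _ hf _) _
        · intro q hq _ r' hr'
          have := hprev (α 1 + α 2) (by simp only [Fin.zero_eta]; omega) q hq r' hr'
          rw [← add_assoc] at this
          exact (this.iterate _).iterate _
      · rw [dirDeriv.iterate_comm]
        refine iterate_dirDeriv_eval_eq_zero (hpar p hp 1) (D := D) ?_ hD ?_
        · exact dirDeriv.totalDegree_iterate_le _ (dirDeriv.totalDegree_iterate_le _ hf _) _
        · intro q hq _ r' hr'
          have := hprev (α 0 + α 2) (by simp only [Fin.mk_one]; omega) q hq r' hr'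
          rw [← add_assoc] at this
          exact (this.iterate _).iterate _
      · rw [dirDeriv.iterate_comm (v p 1).ofLp, dirDeriv.iterate_comm (v p 0).ofLp]
        refine iterate_dirDeriv_eval_eq_zero (hpar p hp 2) (D := D) ?_ hD ?_
        · exact dirDeriv.totalDegree_iterate_le _ (dirDeriv.totalDegree_iterate_le _ hf _) _
        · intro q hq _ r' hr'
          have := hprev (α 0 + α 1) (by simp only [Fin.reduceFinMk]; omega) q hq r' hr'
          rw [← add_assoc] at this
          exact (this.iterate _).iterate _
  obtain ⟨p, hp⟩ := hP
  exact DerivsVanishAt.eq_zero fun r => key _ p hp r rfl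

/-- Parameter counting: the number of conditions is at least the dimension of the space of
polynomials of degree at most `K` in each variable. -/
theorem pow_le_sum_prod_freeOrder {P : Finset R3} (hP : P.Nonempty) (h : R3 → ℕ) (K : ℕ)
    (l : R3 → Fin 3 → AffineSubspace ℝ R3) (v : R3 → Fin 3 → R3)
    (hl : ∀ p ∈ P, ∀ i, p ∈ l p i)
    (hpar : ∀ p ∈ P, ∀ i, ∀ q ∈ l p i, ∃ t : ℝ, q = p + t • v p i)
    (hspan : ∀ p ∈ P, Submodule.span ℝ (Set.range fun i => (v p i).ofLp) = ⊤) :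
    (K + 1) ^ 3 ≤ ∑ p ∈ P, ∏ i, freeOrder P h (3 * K) (l p i) p := by
  by_contra! hlt
  let expo (a : Fin 3 → Fin (K + 1)) : Fin 3 →₀ ℕ := Finsupp.equivFunOnFinite.symm fun i => a i
  have hexpo : Function.Injective expo := by
    intro a b hab
    funext i
    exact Fin.ext (DFunLike.congr_fun hab i)
  let poly : ((Fin 3 → Fin (K + 1)) → ℝ) →ₗ[ℝ] MvPolynomial (Fin 3) ℝ :=
    ∑ a, (monomial (expo a)) ∘ₗ LinearMap.proj a
  have hpoly : ∀ c, poly c = ∑ a, monomial (expo a) (c a) := fun c => by simp [poly]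
  let T (p : R3) (i : Fin 3) : Module.End ℝ (MvPolynomial (Fin 3) ℝ) :=
    (dirDeriv (v p i).ofLp).toLinearMap
  let ev (p : R3) (α : Fin 3 → ℕ) : MvPolynomial (Fin 3) ℝ →ₗ[ℝ] ℝ :=
    (aeval p.ofLp : MvPolynomial (Fin 3) ℝ →ₐ[ℝ] ℝ).toLinearMap ∘ₗ
      ((T p 0 ^ α 0 * T p 1 ^ α 1 * T p 2 ^ α 2 : Module.End ℝ (MvPolynomial (Fin 3) ℝ)))
  let Φ : ((Fin 3 → Fin (K + 1)) → ℝ) →ₗ[ℝ]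
      ((Σ p : P, ∀ i, Fin (freeOrder P h (3 * K) (l p i) p)) → ℝ) :=
    LinearMap.pi fun x => ev x.1 (fun i => x.2 i) ∘ₗ poly
  have hker : LinearMap.ker Φ ≠ ⊥ := by
    apply LinearMap.ker_ne_bot_of_finrank_lt
    rw [Module.finrank_fintype_fun_eq_card, Module.finrank_fintype_fun_eq_card]
    simp only [Fintype.card_sigma, Fintype.card_pi, Fintype.card_fin, Finset.prod_const,
      Finset.card_univ]
    rw [Finset.sum_coe_sort P fun p => ∏ i, freeOrder P h (3 * K) (l p i) p]
    exact hlt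
  obtain ⟨c, hc, hc0⟩ := (Submodule.ne_bot_iff _).1 hker
  apply hc0
  have hf : poly c = 0 := by
    refine eq_zero_of_freeOrder hP h (3 * K) l v hl hpar hspan ?_ ?_
    · rw [hpoly]
      refine totalDegree_finsetSum_le fun a _ => (totalDegree_monomial_le _ _).trans ?_
      rw [Finsupp.sum_fintype _ _ (fun _ => rfl), Fin.sum_univ_three]
      have := (a 0).is_lt
      have := (a 1).is_lt
      have := (a 2).is_lt
      change (a 0 : ℕ) + a 1 + a 2 ≤ 3 * K
      omega
    · intro p hp α hα
      have := congrFun (LinearMap.mem_ker.1 hc) ⟨⟨p, hp⟩, fun i => ⟨α i, hα i⟩⟩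
      simpa [Φ, ev, T, Module.End.pow_apply, aeval_eq_eval] using this
  funext a
  have := congrArg (coeff (expo a)) hf
  rw [hpoly, coeff_sum] at this
  simpa [coeff_monomial, hexpo.eq_iff] using this

/-! ### Joint triples and the choice of handicaps -/

/-- `T` is one of the triples of lines of `𝔏` counted by `jointMultiplicity 𝔏 p`. -/
def IsJointTriple (𝔏 : Finset (AffineSubspace ℝ R3)) (p : R3)
    (T : Finset (AffineSubspace ℝ R3)) : Prop :=
  T ⊆ 𝔏 ∧ T.card = 3 ∧ SpanAt T p

theorem IsLine.exists_direction_eq_span {l : AffineSubspace ℝ R3} (hl : IsLine l) :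
    ∃ v : R3, l.direction = Submodule.span ℝ {v} := by
  obtain ⟨v, -, hv⟩ := finrank_eq_one_iff'.1 hl
  refine ⟨v, le_antisymm (fun w hw => ?_) ?_⟩
  · obtain ⟨c, hc⟩ := hv ⟨w, hw⟩
    exact Submodule.mem_span_singleton.2 ⟨c, congrArg Subtype.val hc⟩
  · rw [Submodule.span_singleton_le_iff_mem]
    exact v.2

/-- Passes from unordered triples to the indexed lines and vectors used above; the last clause
carries products over `T` to products over `Fin 3`. -/
theorem SpanAt.exists_parametrization {T : Finset (AffineSubspace ℝ R3)} {p : R3}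
    (hT : SpanAt T p) (hcard : T.card = 3) (hline : ∀ l ∈ T, IsLine l) :
    ∃ (l : Fin 3 → AffineSubspace ℝ R3) (v : Fin 3 → R3), (∀ i, p ∈ l i) ∧
      (∀ i, ∀ q ∈ l i, ∃ t : ℝ, q = p + t • v i) ∧
      Submodule.span ℝ (Set.range fun i => (v i).ofLp) = ⊤ ∧
      ∀ F : AffineSubspace ℝ R3 → ℕ, ∏ a ∈ T, F a = ∏ i, F (l i) := by
  classical
  obtain ⟨a, b, c, hab, hac, hbc, rfl⟩ := Finset.card_eq_three.1 hcard
  have hl : ∀ i, ![a, b, c] i ∈ ({a, b, c} : Finset (AffineSubspace ℝ R3)) := by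
    intro i; fin_cases i <;> simp
  choose v hv using fun i => (hline _ (hl i)).exists_direction_eq_span
  refine ⟨![a, b, c], v, fun i => hT.1 _ (hl i), ?_, ?_, ?_⟩
  · intro i q hq
    have := AffineSubspace.vsub_mem_direction hq (hT.1 _ (hl i))
    rw [hv, Submodule.mem_span_singleton] at this
    obtain ⟨t, ht⟩ := this
    exact ⟨t, by rw [ht, vsub_eq_sub]; abel⟩
  · have hspan : Submodule.span ℝ (Set.range v) = ⊤ := by
      rw [eq_top_iff, ← hT.2, Submodule.span_range_eq_iSup]
      refine iSup₂_le fun x hx => ?_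
      obtain ⟨i, rfl⟩ : ∃ i, ![a, b, c] i = x := by
        simp only [Finset.mem_insert, Finset.mem_singleton] at hx
        rcases hx with rfl | rfl | rfl
        exacts [⟨0, rfl⟩, ⟨1, rfl⟩, ⟨2, rfl⟩]
      rw [hv]
      exact le_iSup (fun i => Submodule.span ℝ {v i}) i
    have := congrArg (Submodule.map (WithLp.linearEquiv 2 ℝ (Fin 3 → ℝ)).toLinearMap) hspan
    rw [Submodule.map_span, ← Set.range_comp, Submodule.map_top, LinearEquiv.range] at this
    exact this
  · intro F
    rw [Fin.prod_univ_three, Finset.prod_insert (by simp [hab, hac]),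
      Finset.prod_insert (by simpa using hbc), Finset.prod_singleton, mul_assoc]
    rfl

theorem pow_le_sum_prod_triple {𝔏 : Finset (AffineSubspace ℝ R3)} (h𝔏 : ∀ l ∈ 𝔏, IsLine l)
    {P : Finset R3} (hP : P.Nonempty) (h : R3 → ℕ) (K : ℕ)
    (T : R3 → Finset (AffineSubspace ℝ R3)) (hT : ∀ p ∈ P, IsJointTriple 𝔏 p (T p)) :
    (K + 1) ^ 3 ≤ ∑ p ∈ P, ∏ l ∈ T p, freeOrder P h (3 * K) l p := by
  choose! l v hl hpar hspan hprod using fun p hp =>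
    (hT p hp).2.2.exists_parametrization (hT p hp).2.1 fun a ha => h𝔏 a ((hT p hp).1 ha)
  rw [Finset.sum_congr rfl fun p hp => hprod p hp fun a => freeOrder P h (3 * K) a p]
  exact pow_le_sum_prod_freeOrder hP h K l v hl hpar hspan

/-- There is a choice of handicaps that equalizes, in proportion to prescribed weights, the number
of vanishing conditions at the different points. -/
theorem exists_handicap {𝔏 : Finset (AffineSubspace ℝ R3)} (h𝔏 : ∀ l ∈ 𝔏, IsLine l)
    (P : Finset R3) (w : R3 → ℝ) (hw : ∀ p ∈ P, 0 ≤ w p) (hS : 0 < ∑ p ∈ P, w p) (K : ℕ) :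
    ∃ h : R3 → ℕ, ∀ p ∈ P, ∀ T, IsJointTriple 𝔏 p T →
      (K : ℝ) ^ 3 * w p ≤
        (∑ q ∈ P, w q) * ∏ l ∈ T, ((freeOrder P h (3 * K) l p : ℝ) + 1) := by
  classical
  set S := ∑ p ∈ P, w p
  -- Admissible handicaps: `h p` may be positive only if some triple at `p` carries no more than its
  -- share of conditions. The zero handicap is admissible.
  let H (h : R3 → ℕ) : Prop := ∀ p ∈ P, h p = 0 ∨ ∃ T, IsJointTriple 𝔏 p T ∧
    S * ∏ l ∈ T, (freeOrder P h (3 * K) l p : ℝ) ≤ (K : ℝ) ^ 3 * w p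
  have hbdd : ∀ h, H h → ∀ p ∈ P, h p ≤ P.card * (3 * K + 1) := by
    intro h hh p hp
    by_contra! hlarge
    -- Pigeonhole: of `P.card + 1` blocks `(j * (3 * K + 1), (j + 1) * (3 * K + 1)]`, one contains
    -- no handicap. It is longer than the degree bound `3 * K`, so the points above it ignore those
    -- below.
    obtain ⟨j, hj, hjn⟩ : ∃ j ∈ Finset.range (P.card + 1),
        j ∉ P.image fun q => (h q - 1) / (3 * K + 1) :=
      Finset.exists_mem_notMem_of_card_lt_card
        (Finset.card_image_le.trans_lt (by rw [Finset.card_range]; omega))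
    have hgap : ∀ q ∈ P, j * (3 * K + 1) < h q → (j + 1) * (3 * K + 1) < h q := by
      intro q hq hlt
      have h1 : j ≤ (h q - 1) / (3 * K + 1) :=
        (Nat.le_div_iff_mul_le (by omega)).2 (by omega)
      have h2 : j ≠ (h q - 1) / (3 * K + 1) := fun he =>
        hjn (Finset.mem_image.2 ⟨q, hq, he.symm⟩)
      have h3 := (Nat.le_div_iff_mul_le (by omega)).1 (Nat.succ_le_of_lt (lt_of_le_of_ne h1 h2))
      rw [Nat.succ_eq_add_one] at h3
      omega
    set A := P.filter fun q => j * (3 * K + 1) < h q with hA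
    have hAne : A.Nonempty := by
      refine ⟨p, Finset.mem_filter.2 ⟨hp, lt_of_le_of_lt (Nat.mul_le_mul_right _ ?_) hlarge⟩⟩
      have := Finset.mem_range.1 hj
      omega
    have hAT : ∀ q ∈ A, ∃ T, IsJointTriple 𝔏 q T ∧
        S * ∏ l ∈ T, (freeOrder P h (3 * K) l q : ℝ) ≤ (K : ℝ) ^ 3 * w q := by
      intro q hq
      obtain ⟨hqP, hq⟩ := Finset.mem_filter.1 hq
      exact (hh q hqP).resolve_left (by omega)
    choose! T hT hTle using hAT
    have hcount := pow_le_sum_prod_triple h𝔏 hAne h K T hT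
    have heq : ∀ q ∈ A, ∏ l ∈ T q, freeOrder A h (3 * K) l q =
        ∏ l ∈ T q, freeOrder P h (3 * K) l q := by
      intro q hq
      refine Finset.prod_congr rfl fun l hl => ?_
      refine freeOrder_eq_of_gap (Finset.filter_subset _ _) hq ((hT q hq).2.2.1 l hl) ?_
      intro a ha haA
      have h1 : h a ≤ j * (3 * K + 1) := by
        by_contra! h1
        exact haA (Finset.mem_filter.2 ⟨ha, h1⟩)
      obtain ⟨hqP, hq⟩ := Finset.mem_filter.1 hq
      have h2 := hgap q hqP hq
      rw [add_mul] at h2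
      omega
    rw [Finset.sum_congr rfl heq] at hcount
    have hcount' : ((K : ℝ) + 1) ^ 3 ≤
        ∑ q ∈ A, ∏ l ∈ T q, (freeOrder P h (3 * K) l q : ℝ) := by exact_mod_cast hcount
    -- All points of `A` have positive handicap, so their shares total at most `K ^ 3`, whereas
    -- parameter counting on `A` alone demands `(K + 1) ^ 3`.
    have h1 : S * ((K : ℝ) + 1) ^ 3 ≤ (K : ℝ) ^ 3 * S := by
      calc S * ((K : ℝ) + 1) ^ 3
          ≤ S * ∑ q ∈ A, ∏ l ∈ T q, (freeOrder P h (3 * K) l q : ℝ) :=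
            mul_le_mul_of_nonneg_left hcount' hS.le
        _ ≤ ∑ q ∈ A, (K : ℝ) ^ 3 * w q := by
            rw [Finset.mul_sum]
            exact Finset.sum_le_sum hTle
        _ ≤ ∑ q ∈ P, (K : ℝ) ^ 3 * w q :=
            Finset.sum_le_sum_of_subset_of_nonneg (Finset.filter_subset _ _)
              fun q hq _ => mul_nonneg (by positivity) (hw q hq)
        _ = (K : ℝ) ^ 3 * S := by rw [← Finset.mul_sum]
    have h2 : (K : ℝ) ^ 3 < ((K : ℝ) + 1) ^ 3 := by gcongr; linarith
    nlinarith
  -- Take an admissible handicap of maximal sum: if the claim failed at `p`, raising `h p` by one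
  -- would remain admissible.
  let V : Set ℕ := {m | ∃ h, H h ∧ ∑ p ∈ P, h p = m}
  have hVb : BddAbove V := by
    refine ⟨∑ _p ∈ P, P.card * (3 * K + 1), ?_⟩
    rintro m ⟨h, hh, rfl⟩
    exact Finset.sum_le_sum (hbdd h hh)
  obtain ⟨h, hh, hmax⟩ : sSup V ∈ V :=
    Nat.sSup_mem ⟨0, fun _ => 0, fun _ _ => Or.inl rfl, by simp⟩ hVb
  refine ⟨h, fun p hp T hT => ?_⟩
  by_contra! hlt
  have hnew : H (Function.update h p (h p + 1)) := by
    intro q hq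
    by_cases hqp : q = p
    · subst hqp
      refine Or.inr ⟨T, hT, le_trans ?_ hlt.le⟩
      refine mul_le_mul_of_nonneg_left (Finset.prod_le_prod (fun _ _ => by positivity) ?_) hS.le
      intro l hl
      exact_mod_cast freeOrder_update_self_le hq (hT.2.2.1 l hl)
    · rw [Function.update_of_ne hqp]
      refine (hh q hq).imp_right ?_
      rintro ⟨T', hT', hle⟩
      refine ⟨T', hT', le_trans ?_ hle⟩
      refine mul_le_mul_of_nonneg_left (Finset.prod_le_prod (fun _ _ => by positivity) ?_) hS.le
      intro l hl
      exact_mod_cast freeOrder_update_of_ne_le hq (hT'.2.2.1 l hl) hqp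
  have hle := le_csSup hVb ⟨_, hnew, rfl⟩
  rw [← hmax] at hle
  refine hle.not_gt (Finset.sum_lt_sum (fun q _ => ?_) ⟨p, hp, by simp⟩)
  rw [Function.update_apply]
  split_ifs with hq
  · subst hq; omega
  · exact le_rfl

/-! ### Summation over triples, points and lines -/

/-- The elementary symmetric functions of nonnegative reals are at most powers of their sum. -/
theorem Finset.sum_powersetCard_prod_le {ι : Type*} (s : Finset ι) (b : ι → ℝ)
    (hb : ∀ i ∈ s, 0 ≤ b i) (k : ℕ) :
    ∑ T ∈ s.powersetCard k, ∏ i ∈ T, b i ≤ (∑ i ∈ s, b i) ^ k := by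
  classical
  induction s using Finset.induction_on generalizing k with
  | empty =>
    cases k with
    | zero => simp
    | succ k => rw [Finset.powersetCard_eq_empty.2 (by simp)]; simp
  | insert a s ha ih =>
    have hb' : ∀ i ∈ s, 0 ≤ b i := fun i hi => hb i (Finset.mem_insert_of_mem hi)
    have h0 : 0 ≤ ∑ i ∈ s, b i := Finset.sum_nonneg hb'
    have ha0 : 0 ≤ b a := hb a (Finset.mem_insert_self a s)
    cases k with
    | zero => simp
    | succ k =>
      have hdisj : Disjoint (s.powersetCard (k + 1)) ((s.powersetCard k).image (insert a)) := by
        rw [Finset.disjoint_left]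
        intro T hT hT'
        obtain ⟨U, -, rfl⟩ := Finset.mem_image.1 hT'
        exact ha ((Finset.mem_powersetCard.1 hT).1 (Finset.mem_insert_self a U))
      have hmem : ∀ U ∈ s.powersetCard k, a ∉ U := fun U hU haU =>
        ha ((Finset.mem_powersetCard.1 hU).1 haU)
      rw [Finset.powersetCard_succ_insert ha, Finset.sum_union hdisj, Finset.sum_image
        (fun U hU U' hU' he => by
          rw [← Finset.erase_insert (hmem U hU), he, Finset.erase_insert (hmem U' hU')]),
        Finset.sum_congr rfl fun U hU => Finset.prod_insert (hmem U hU), ← Finset.mul_sum,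
        Finset.sum_insert ha]
      calc _ ≤ (∑ i ∈ s, b i) ^ (k + 1) + b a * (∑ i ∈ s, b i) ^ k :=
            add_le_add (ih hb' _) (mul_le_mul_of_nonneg_left (ih hb' _) ha0)
        _ = (b a + ∑ i ∈ s, b i) * (∑ i ∈ s, b i) ^ k := by ring
        _ ≤ (b a + ∑ i ∈ s, b i) * (b a + ∑ i ∈ s, b i) ^ k := by
            gcongr
            linarith
        _ = _ := by ring

theorem jointMultiplicity_eq_card (𝔏 : Finset (AffineSubspace ℝ R3)) (p : R3)
    [DecidablePred (IsJointTriple 𝔏 p)] :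
    jointMultiplicity 𝔏 p = ((𝔏.powersetCard 3).filter (IsJointTriple 𝔏 p)).card := by
  rw [jointMultiplicity, ← Set.ncard_coe_finset]
  congr 1
  ext T
  simp only [Finset.coe_filter, Finset.mem_powersetCard]
  exact ⟨fun h => ⟨⟨h.1, h.2.1⟩, h⟩, fun h => h.2⟩

theorem IsLine.inter_subsingleton {l m : AffineSubspace ℝ R3} (hl : IsLine l) (hm : IsLine m)
    (hlm : l ≠ m) : ((l : Set R3) ∩ m).Subsingleton := by
  rintro x ⟨hxl, hxm⟩ y ⟨hyl, hym⟩
  by_contra hxy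
  have key : ∀ {k : AffineSubspace ℝ R3}, IsLine k → x ∈ k → y ∈ k →
      k.direction = Submodule.span ℝ {y -ᵥ x} := by
    intro k hk hx hy
    refine (Submodule.eq_of_le_of_finrank_le ?_ ?_).symm
    · rw [Submodule.span_singleton_le_iff_mem]
      exact AffineSubspace.vsub_mem_direction hy hx
    · rw [finrank_span_singleton (vsub_ne_zero.2 (Ne.symm hxy))]
      exact hk.le
  exact hlm (AffineSubspace.ext_of_direction_eq
    ((key hl hxl hyl).trans (key hm hxm hym).symm) ⟨x, hxl, hxm⟩)

/-- Every joint is the intersection point of two distinct lines of `𝔏`. -/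
theorem joints_finite {𝔏 : Finset (AffineSubspace ℝ R3)} (h𝔏 : ∀ l ∈ 𝔏, IsLine l) :
    (joints 𝔏).Finite := by
  classical
  refine Set.Finite.subset (s := ⋃ a ∈ 𝔏.offDiag, ((a.1 : Set R3) ∩ a.2)) ?_ ?_
  · refine Set.Finite.biUnion (Finset.finite_toSet _) fun a ha => ?_
    obtain ⟨h1, h2, h3⟩ := Finset.mem_offDiag.1 ha
    exact ((h𝔏 _ h1).inter_subsingleton (h𝔏 _ h2) h3).finite
  · rintro x ⟨T, hT, hcard, hx, -⟩
    obtain ⟨l, hl, m, hm, hlm⟩ := Finset.one_lt_card.1 (by omega : 1 < T.card)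
    exact Set.mem_biUnion (x := (l, m)) (Finset.mem_offDiag.2 ⟨hT hl, hT hm, hlm⟩)
      ⟨hx l hl, hx m hm⟩

/-- The bound of the theorem for the part of the sum over an arbitrary finite set of points. -/
theorem sum_sqrt_jointMultiplicity_le {𝔏 : Finset (AffineSubspace ℝ R3)}
    (h𝔏 : ∀ l ∈ 𝔏, IsLine l) (P : Finset R3) :
    ∑ p ∈ P, (jointMultiplicity 𝔏 p : ℝ) ^ (1 / 2 : ℝ) ≤
      (5 : ℝ) ^ (3 / 2 : ℝ) * (𝔏.card : ℝ) ^ (3 / 2 : ℝ) := by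
  classical
  set w : R3 → ℝ := fun p => (jointMultiplicity 𝔏 p : ℝ) ^ (1 / 2 : ℝ)
  have hw : ∀ p, 0 ≤ w p := fun p => by positivity
  have hwsq : ∀ p, (jointMultiplicity 𝔏 p : ℝ) = w p ^ 2 := fun p => by
    change _ = ((jointMultiplicity 𝔏 p : ℝ) ^ (1 / 2 : ℝ)) ^ 2
    rw [← Real.rpow_natCast, ← Real.rpow_mul (by positivity)]
    norm_num
  set S := ∑ p ∈ P, w p with hS_def
  have hS0 : 0 ≤ S := Finset.sum_nonneg fun p _ => hw p
  rcases hS0.eq_or_lt with hS | hS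
  · rw [← hS]
    exact mul_nonneg (by positivity) (Real.rpow_nonneg (Nat.cast_nonneg _) _)
  have hcard : 0 < P.card := by
    rw [Finset.card_pos, Finset.nonempty_iff_ne_empty]
    rintro rfl
    exact hS.ne' (hS_def.trans Finset.sum_empty)
  -- The choice `K = P.card` makes the error terms of size `P.card` comparable with the degree `3 *
  -- K`, so no limit is needed.
  obtain ⟨h, hh⟩ := exists_handicap h𝔏 P w (fun p _ => hw p) hS P.card
  set n := P.card
  set B : AffineSubspace ℝ R3 → R3 → ℝ := fun l p => (freeOrder P h (3 * n) l p : ℝ) + 1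
  have hB : ∀ l p, 0 ≤ B l p := fun l p => by positivity
  set σ : ℝ := S ^ (1 / 3 : ℝ)
  have hσ : 0 ≤ σ := Real.rpow_nonneg hS0 _
  have hσ3 : σ ^ 3 = S := by
    rw [← Real.rpow_natCast, ← Real.rpow_mul hS.le]
    norm_num
  have hpoint : ∀ p ∈ P, n * w p ≤ σ * ∑ l ∈ 𝔏 with p ∈ l, B l p := by
    intro p hp
    have h0 : 0 ≤ ∑ l ∈ 𝔏 with p ∈ l, B l p := Finset.sum_nonneg fun l _ => hB l p
    refine le_of_pow_le_pow_left₀ three_ne_zero (mul_nonneg hσ h0) ?_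
    set Ts := (𝔏.powersetCard 3).filter (IsJointTriple 𝔏 p)
    calc (n * w p) ^ 3 = ∑ _T ∈ Ts, (n : ℝ) ^ 3 * w p := by
          rw [Finset.sum_const, nsmul_eq_mul, ← jointMultiplicity_eq_card, hwsq]
          ring
      _ ≤ ∑ T ∈ Ts, S * ∏ l ∈ T, B l p :=
          Finset.sum_le_sum fun T hT => hh p hp T (Finset.mem_filter.1 hT).2
      _ ≤ ∑ T ∈ (𝔏.filter (p ∈ ·)).powersetCard 3, S * ∏ l ∈ T, B l p := by
          refine Finset.sum_le_sum_of_subset_of_nonneg (fun T hT => ?_) fun T _ _ =>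
            mul_nonneg hS.le (Finset.prod_nonneg fun l _ => hB l p)
          obtain ⟨-, hT1, hT2, hT3⟩ := Finset.mem_filter.1 hT
          exact Finset.mem_powersetCard.2
            ⟨fun l hl => Finset.mem_filter.2 ⟨hT1 hl, hT3.1 l hl⟩, hT2⟩
      _ ≤ S * (∑ l ∈ 𝔏 with p ∈ l, B l p) ^ 3 := by
          rw [← Finset.mul_sum]
          exact mul_le_mul_of_nonneg_left
            (Finset.sum_powersetCard_prod_le _ _ (fun l _ => hB l p) 3) hS.le
      _ = (σ * ∑ l ∈ 𝔏 with p ∈ l, B l p) ^ 3 := by rw [mul_pow, hσ3]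
  -- `5 * n` is `3 * n` from the degree, `n` from ties, and `n` from the `+ 1` in `B`.
  have hline : ∀ l ∈ 𝔏, ∑ p ∈ P with p ∈ l, B l p ≤ 5 * n := by
    intro l _
    have h1 : ∑ p ∈ P with p ∈ l, (freeOrder P h (3 * n) l p : ℝ) ≤ 3 * n + n := by
      exact_mod_cast sum_freeOrder_le P h (3 * n) l
    have h2 : ((P.filter (· ∈ l)).card : ℝ) ≤ n := by exact_mod_cast Finset.card_filter_le _ _
    simp only [B, Finset.sum_add_distrib, Finset.sum_const, nsmul_eq_mul, mul_one]
    linarith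
  have htotal : n * S ≤ n * (σ * (5 * 𝔏.card)) := by
    calc n * S ≤ ∑ p ∈ P, σ * ∑ l ∈ 𝔏 with p ∈ l, B l p := by
          rw [hS_def, Finset.mul_sum]
          exact Finset.sum_le_sum hpoint
      _ = σ * ∑ l ∈ 𝔏, ∑ p ∈ P with p ∈ l, B l p := by
          rw [← Finset.mul_sum]
          simp only [Finset.sum_filter]
          rw [Finset.sum_comm]
      _ ≤ σ * ∑ _l ∈ 𝔏, (5 * n : ℝ) := mul_le_mul_of_nonneg_left (Finset.sum_le_sum hline) hσ
      _ = n * (σ * (5 * 𝔏.card)) := by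
          rw [Finset.sum_const, nsmul_eq_mul]
          ring
  have hS' : S ≤ σ * (5 * 𝔏.card) :=
    le_of_mul_le_mul_left htotal (by exact_mod_cast hcard)
  have hσpos : 0 < σ := Real.rpow_pos_of_pos hS _
  have hσ2 : σ ^ 2 ≤ 5 * 𝔏.card := by
    refine le_of_mul_le_mul_left ?_ hσpos
    calc σ * σ ^ 2 = S := by rw [← hσ3]; ring
      _ ≤ _ := hS'
  calc S = (σ ^ 2) ^ (3 / 2 : ℝ) := by
        rw [← hσ3, ← Real.rpow_natCast, ← Real.rpow_natCast, ← Real.rpow_mul hσ]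
        norm_num
    _ ≤ (5 * 𝔏.card : ℝ) ^ (3 / 2 : ℝ) := Real.rpow_le_rpow (pow_nonneg hσ 2) hσ2 (by norm_num)
    _ = _ := Real.mul_rpow (by norm_num) (Nat.cast_nonneg _)

theorem theorem1p1 :
    ∃ c : ℝ, ∀ 𝔏 : Finset (AffineSubspace ℝ R3), (∀ l ∈ 𝔏, IsLine l) →
      ∃ hJ : (joints 𝔏).Finite,
        ∑ x ∈ hJ.toFinset, (jointMultiplicity 𝔏 x : ℝ) ^ (1 / 2 : ℝ) ≤
          c * (𝔏.card : ℝ) ^ (3 / 2 : ℝ) :=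
  ⟨(5 : ℝ) ^ (3 / 2 : ℝ), fun _ h𝔏 => ⟨joints_finite h𝔏, sum_sqrt_jointMultiplicity_le h𝔏 _⟩⟩
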